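/- Let $\mu$ be a cardinal, $\lambda = \mu^+$, and let $\delta(*)$ be a limit ordinal with $|\delta(*)| < \mu$ and $\mathrm{cf}(\delta(*)) \neq \mathrm{cf}(\mu)$. Then there are a stationary set $S \subseteq \{\delta < \lambda : \mathrm{cf}(\delta) = \mathrm{cf}(\delta(*))\}$ and a sequence $\bar{\mathcal P} = \langle \mathcal P_\alpha : \alpha < \lambda\rangle$ such that: (i) for every $\alpha < \lambda$, $\mathcal P_\alpha$ is a family of closed subsets of $\alpha$ and $|\mathcal P_\alpha| < \lambda$; (ii) if $\alpha \in \lambda \setminus S$ and $C \in \mathcal P_\alpha$, then $\mathrm{otp}(C) < \delta(*)$; (iii) if $\alpha \in S$, then $\mathcal P_\alpha = \{C_\alpha\}$ for some club $C_\alpha$ of $\alpha$ with $\mathrm{otp}(C_\alpha) = \delta(*)$ and $C_\alpha \cap S = \emptyset$; (iv) if $\alpha < \lambda$, $C \in \mathcal P_\alpha$ and $\beta \in \mathrm{nacc}(C)$, then $C \cap \beta \in \mathcal P_\beta$; (v) for every club $E$ of $\lambda$ there is $\delta \in S$ with $C_\delta \subseteq E$. Here $\mathrm{otp}$ denotes order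 type, and $\mathrm{nacc}(C)$ is the set of those $\beta \in C$ that are not limits of elements of $C$ below $\beta$. -/

import Mathlib

universe u

open Set Cardinal
open scoped Ordinal Set.Notation

namespace ClubGuessing

/-- `C` is a closed subset of the ordinal `α` (identified with the set `Iio α` of ordinals below
`α`, with its order topology). -/
def IsClosedIn (C : Set Ordinal.{u}) (α : Ordinal.{u}) : Prop :=
  C ⊆ Iio α ∧ IsClosed (Iio α ↓∩ C)

/-- `C` is a club (closed unbounded subset) of the ordinal `α`. -/
def IsClubIn (C : Set Ordinal.{u}) (α : Ordinal.{u}) : Prop :=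
  C ⊆ Iio α ∧ IsClub (Iio α ↓∩ C)

/-- `S` is a stationary subset of the ordinal `α`. -/
def IsStationaryIn (S : Set Ordinal.{u}) (α : Ordinal.{u}) : Prop :=
  S ⊆ Iio α ∧ IsStationary (Iio α ↓∩ S)

/-- The set of non-accumulation members of `C`: those `β ∈ C` that are not limits of
members of `C` below `β`. -/
def nacc (C : Set Ordinal.{u}) : Set Ordinal.{u} :=
  {β ∈ C | ¬ AccPt β (Filter.principal C)}

/-- The order type of a set of ordinals. -/
noncomputable def otp (C : Set Ordinal.{u}) : Ordinal.{u + 1} :=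
  typeLT C

/-- The family `P = ⟨P α : α < lam⟩` guesses clubs of the cardinal `lam` on `S` by
sets of order type `δ`, with one guess at each point of `S` and with coherence. Only the values
`P α` for `α < lam` matter. -/
structure GuessesClubs (lam : Cardinal.{u}) (δ : Ordinal.{u})
    (P : Ordinal.{u} → Set (Set Ordinal.{u})) (S : Set Ordinal.{u}) : Prop where
  /-- `P α` is a family of fewer than `lam` closed subsets of `α`. -/
  closed : ∀ α < lam.ord, (∀ C ∈ P α, IsClosedIn C α) ∧ #(P α) < Cardinal.lift.{u + 1} lam
  /-- Off `S`, the members of `P α` have order type less than `δ`. -/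
  otp_lt : ∀ α < lam.ord, α ∉ S → ∀ C ∈ P α, otp C < Ordinal.lift.{u + 1} δ
  /-- On `S`, the family `P α` is a singleton, whose member is a club of `α` of order type `δ`
  that is disjoint from `S`. -/
  guess : ∀ α ∈ S, ∃ C, P α = {C} ∧ otp C = Ordinal.lift.{u + 1} δ ∧ IsClubIn C α ∧ Disjoint C S
  /-- Coherence under initial segments at non-accumulation points. -/
  coherent : ∀ α < lam.ord, ∀ C ∈ P α, ∀ β ∈ nacc C, C ∩ Iio β ∈ P β
  /-- Every club of `lam` includes the guess at some point of `S`. -/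
  guesses : ∀ E, IsClubIn E lam.ord → ∃ α ∈ S, ∃ C ∈ P α, C ⊆ E

end ClubGuessing

namespace ClubGuessing

/-! The engine is `exists_stable`. If every club can be shrunk so as to spoil its guesses, then
after `mu` shrinkings some ordinal-valued parameter, attached to one of fewer than `mu` arguments,
has dropped infinitely often, which is absurd. It is used twice.

The first use is for a regular cardinal κ. Each β < κ⁺ carries coherent approximations of size less
than κ (`exists_coherent_filtration`). Project an approximation to a stable club E' by x ↦ max(E' ∩
[0, x]) and close it. For every club some approximation gives a set inside it, and coherence leaves
few initial segments: `exists_guessSystem_of_isRegular`. As `mu` may be singular, the system is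
built on |δ|⁺⁺ and, if necessary, lifted to `mu`⁺ by `GuessSystem.exists_of_lt`.

Such a system still lets the sequence depend on the club. The second use, in
`exists_guess_sequence`, fixes one sequence per point γ. Enumerate γ and the families of segments in
type `mu`. Since cf(δ) ≠ cf(`mu`), the indices met along a sequence are cofinally often below some χ
< `mu` (`exists_cofinal_le`). So fewer than `mu` sets control all candidates at γ. Once it is stable
which of these sets lie in the club, all candidates inside E' are equally good.

Finally S is one class of a colouring with `mu` colours that separates γ from the members of its
sequence, and the families consist of the initial segments of the chosen sequences. -/

/-! ### Clubs, bounds and recursion -/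

theorem isClubIn_iff {E : Set Ordinal.{u}} {o : Ordinal.{u}} :
    IsClubIn E o ↔ E ⊆ Iio o ∧ (∀ x < o, ∃ y ∈ E, x ≤ y) ∧
      ∀ x < o, x ≠ 0 → (∀ y < x, ∃ z ∈ E, y < z ∧ z ≤ x) → x ∈ E := by
  refine and_congr_right fun hE ↦ ⟨fun h ↦ ⟨fun x hx ↦ ?_, fun x hx hx0 h' ↦ ?_⟩, fun h ↦ ⟨?_, ?_⟩⟩
  · obtain ⟨y, hy, hxy⟩ := h.isCofinal ⟨x, hx⟩
    exact ⟨y, hy, hxy⟩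
  · refine IsClub.isLUB_mem (t := {z : Iio o | (z : Ordinal) ∈ E ∧ (z : Ordinal) ≤ x})
      (x := (⟨x, hx⟩ : Iio o)) h (fun z hz ↦ hz.1) ?_ ⟨fun z hz ↦ hz.2, fun b hb ↦ ?_⟩
    · obtain ⟨z, hz, -, hzx⟩ := h' 0 (pos_iff_ne_zero.2 hx0)
      exact ⟨⟨z, hE hz⟩, hz, hzx⟩
    · by_contra hbx
      obtain ⟨z, hz, hbz, hzx⟩ := h' b (lt_of_not_ge hbx)
      exact hbz.not_ge (hb (a := ⟨z, hE hz⟩) ⟨hz, hzx⟩)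
  · intro t ht ht0 _ a ha
    rcases eq_or_ne (a : Ordinal) 0 with h0 | h0
    · obtain ⟨b, hb⟩ := ht0
      have : b = a := le_antisymm (ha.1 hb) (by rw [← Subtype.coe_le_coe, h0]; exact zero_le)
      exact this ▸ ht hb
    · refine h.2 a a.2 h0 fun y hy ↦ ?_
      obtain ⟨z, hz, hyz⟩ :=
        (lt_isLUB_iff ha).1 (show (⟨y, lt_trans hy a.2⟩ : Iio o) < a from hy)
      exact ⟨z, ht hz, hyz, ha.1 hz⟩
  · intro x
    obtain ⟨y, hy, hxy⟩ := h.1 x x.2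
    exact ⟨⟨y, hE hy⟩, hy, hxy⟩

theorem IsClubIn.exists_gt {E : Set Ordinal.{u}} {c : Cardinal.{u}} (hE : IsClubIn E c.ord)
    (hc : ℵ₀ ≤ c) {x : Ordinal.{u}} (hx : x < c.ord) : ∃ y ∈ E, x < y := by
  obtain ⟨y, hy, hxy⟩ := (isClubIn_iff.1 hE).2.1 _ ((isSuccLimit_ord hc).succ_lt hx)
  exact ⟨y, hy, (Order.lt_succ x).trans_le hxy⟩

theorem isClubIn_forall {ι : Type (u + 1)} {c : Cardinal.{u}} (hc : c.IsRegular) (hc' : ℵ₀ < c)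
    (hι : #ι < Cardinal.lift.{u + 1} c) {f : ι → Set Ordinal.{u}}
    (hf : ∀ i, IsClubIn (f i) c.ord) : IsClubIn {x | x < c.ord ∧ ∀ i, x ∈ f i} c.ord := by
  have hcof : Order.cof (Iio c.ord) = Cardinal.lift.{u + 1} c := by
    rw [Ordinal.cof_Iio, ← Ordinal.lift_cof, hc.cof_ord]
  refine ⟨fun x hx ↦ hx.1, ?_⟩
  have : Iio c.ord ↓∩ {x | x < c.ord ∧ ∀ i, x ∈ f i} = ⋂ i, Iio c.ord ↓∩ f i := by
    ext x
    have hx : (x : Ordinal) < c.ord := x.2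
    simp [hx]
  rw [this]
  refine IsClub.iInter ?_ ?_ fun i ↦ (hf i).2
  · rw [hcof]
    exact (aleph0_lt_lift.2 hc').ne'
  · rwa [hcof, Cardinal.lift_id, Cardinal.lift_id]

theorem IsClubIn.inter {c : Cardinal.{u}} (hc : c.IsRegular) (hc' : ℵ₀ < c)
    {E F : Set Ordinal.{u}} (hE : IsClubIn E c.ord) (hF : IsClubIn F c.ord) :
    IsClubIn (E ∩ F) c.ord := by
  refine ⟨fun x hx ↦ hE.1 hx.1, ?_⟩
  refine IsClub.inter ?_ hE.2 hF.2
  rw [Ordinal.cof_Iio, ← Ordinal.lift_cof, hc.cof_ord]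
  exact (aleph0_lt_lift.2 hc').ne'

theorem exists_bound_of_lt_cof {ι : Type (u + 1)} {o : Ordinal.{u}}
    (hι : #ι < Cardinal.lift.{u + 1} o.cof) {f : ι → Ordinal.{u}} (hf : ∀ i, f i < o) :
    ∃ b < o, ∀ i, f i ≤ b := by
  refine ⟨sSup (range f), Ordinal.sSup_lt_of_lt_cof ?_ (by rintro _ ⟨i, rfl⟩; exact hf i),
    fun i ↦ le_csSup ⟨o, by rintro _ ⟨j, rfl⟩; exact (hf j).le⟩ ⟨i, rfl⟩⟩
  rw [← Ordinal.lift_cof]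
  exact mk_range_le.trans_lt hι

theorem exists_bound {ι : Type (u + 1)} {c : Cardinal.{u}} (hc : c.IsRegular)
    (hι : #ι < Cardinal.lift.{u + 1} c) {f : ι → Ordinal.{u}} (hf : ∀ i, f i < c.ord) :
    ∃ b < c.ord, ∀ i, f i ≤ b :=
  exists_bound_of_lt_cof (by rwa [hc.cof_ord]) hf

theorem mk_Iio_lt {c : Cardinal.{u}} {o : Ordinal.{u}} (ho : o < c.ord) :
    #(Iio o) < Cardinal.lift.{u + 1} c := by
  rw [mk_Iio_ordinal, Cardinal.lift_lt]
  exact lt_ord.1 ho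

theorem mk_image_Iio_lt {τ : Type (u + 1)} {c : Cardinal.{u}} {o : Ordinal.{u}} (ho : o < c.ord)
    (f : Ordinal.{u} → τ) : #(f '' Iio o) < Cardinal.lift.{u + 1} c :=
  mk_image_le.trans_lt (mk_Iio_lt ho)

theorem exists_subset_image_Iio {τ : Type (u + 1)} [Nonempty τ] {c : Cardinal.{u}} {T : Set τ}
    (hT : #T ≤ Cardinal.lift.{u + 1} c) : ∃ f : Ordinal.{u} → τ, T ⊆ f '' Iio c.ord := by
  have : #T ≤ #(Iio c.ord) := by rwa [mk_Iio_ordinal, card_ord]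
  obtain ⟨g⟩ := this
  classical
  refine ⟨fun o ↦ if h : ∃ x : T, (g x : Ordinal) = o then h.choose else Classical.arbitrary τ,
    fun x hx ↦ ⟨g ⟨x, hx⟩, (g ⟨x, hx⟩).2, ?_⟩⟩
  have h : ∃ y : T, (g y : Ordinal) = g ⟨x, hx⟩ := ⟨_, rfl⟩
  have h' : h.choose = ⟨x, hx⟩ := g.injective (Subtype.ext h.choose_spec)
  simp only [dif_pos h]
  rw [h']

/-- Only the agreement of `g` with `F` below `i` is recorded, so each application must check that `G
i` ignores the other values. -/
theorem exists_recursion {τ : Type*} [Nonempty τ] (G : Ordinal.{u} → (Ordinal.{u} → τ) → τ) :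
    ∃ F : Ordinal.{u} → τ, ∀ i, ∃ g : Ordinal.{u} → τ, (∀ j < i, g j = F j) ∧ F i = G i g := by
  classical
  let F := WellFoundedLT.fix fun i (rec : ∀ j < i, τ) ↦
    G i fun j ↦ if h : j < i then rec j h else Classical.arbitrary τ
  exact ⟨F, fun i ↦ ⟨fun j ↦ if h : j < i then F j else Classical.arbitrary τ,
    fun j hj ↦ by simp [hj], WellFoundedLT.fix_eq _ _⟩⟩

/-! ### Stabilisation along shrinking clubs -/

/-- A family of ordinal-valued functions which decrease as the club `E` shrinks is constant below
some club, on small sets of arguments. -/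
theorem exists_stable {mu : Cardinal.{u}} (hmu : ℵ₀ ≤ mu) {ι J : Type (u + 1)}
    {r : Set Ordinal.{u} → J → Ordinal.{u}} (hr : ∀ E E', E' ⊆ E → ∀ x, r E' x ≤ r E x)
    {A : ι → Set J} (hA : ∀ s, #(A s) < Cardinal.lift.{u + 1} mu)
    {G : ι → Set Ordinal.{u} → Prop} (hG : ∀ s E E', E' ⊆ E → G s E' → G s E)
    (h : ∀ E, IsClubIn E (Order.succ mu).ord → ∃ s, G s E) :
    ∃ E', IsClubIn E' (Order.succ mu).ord ∧ ∀ E, IsClubIn E (Order.succ mu).ord → E ⊆ E' →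
      ∃ s, G s E ∧ ∀ x ∈ A s, r E x = r E' x := by
  by_contra! H
  have hreg := isRegular_succ hmu
  have hunc : ℵ₀ < Order.succ mu := hmu.trans_lt (Order.lt_succ mu)
  set lam := Order.succ mu
  have H' : ∀ E', ∃ E, IsClubIn E' lam.ord → IsClubIn E lam.ord ∧ E ⊆ E' ∧
      ∀ s, G s E → ∃ x ∈ A s, r E x ≠ r E' x := fun E' ↦ by
    by_cases h' : IsClubIn E' lam.ord
    · obtain ⟨E, h1, h2, h3⟩ := H E' h'
      exact ⟨E, fun _ ↦ ⟨h1, h2, h3⟩⟩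
    · exact ⟨∅, fun h ↦ absurd h h'⟩
  choose Φ hΦ using H'
  -- Each `F i` lies inside the counterexample `Φ (F l)` for every l < i. The index `s` obtained for
  -- the club at stage `mu` works at all earlier stages, so `r` drops at each of them on some
  -- argument in `A s`. An infinite fibre suffices, so `mu` need not be regular.
  obtain ⟨F, hF⟩ := exists_recursion
    (fun i (g : Ordinal.{u} → Set Ordinal.{u}) ↦ {x | x < lam.ord ∧ ∀ l : Iio i, x ∈ Φ (g l)})
  have hF' : ∀ i, F i = {x | x < lam.ord ∧ ∀ l : Iio i, x ∈ Φ (F l)} := fun i ↦ by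
    obtain ⟨g, hg, hFi⟩ := hF i
    rw [hFi]
    ext x
    refine and_congr_right fun _ ↦ forall_congr' fun l ↦ ?_
    rw [hg l l.2]
  have hclub : ∀ i < lam.ord, IsClubIn (F i) lam.ord := by
    intro i
    induction i using WellFoundedLT.induction with
    | ind i ih =>
      intro hi
      rw [hF']
      exact isClubIn_forall hreg hunc (mk_Iio_lt hi)
        fun l ↦ (hΦ _ (ih l l.2 (lt_trans l.2 hi))).1
  have hanti : ∀ i j, i < j → F j ⊆ Φ (F i) := fun i j hij x hx ↦ by
    rw [hF'] at hx
    exact hx.2 ⟨i, hij⟩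
  have hlt : mu.ord < lam.ord := ord_lt_ord.2 (Order.lt_succ mu)
  obtain ⟨s, hs⟩ := h _ (hclub _ hlt)
  have hx : ∀ i : Iio mu.ord, ∃ x : A s, r (Φ (F i)) x ≠ r (F i) x := fun i ↦ by
    obtain ⟨x, hx, hne⟩ := (hΦ _ (hclub i (lt_trans i.2 hlt))).2.2 s (hG _ _ _ (hanti _ _ i.2) hs)
    exact ⟨⟨x, hx⟩, hne⟩
  choose x hx using hx
  have hcard : #(Iio mu.ord) = Cardinal.lift.{u + 1} mu := by rw [mk_Iio_ordinal, card_ord]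
  have : Infinite (Iio mu.ord) := by
    rw [infinite_iff, hcard]
    exact aleph0_le_lift.2 hmu
  obtain ⟨y, hy⟩ := exists_infinite_fiber x (by rw [hcard]; exact hA s)
  have hdec : ∀ i j : (x ⁻¹' {y}), i < j → r (F j) y < r (F i) y := fun i j hij ↦ by
    have h1 := hx i
    rw [show x i = y from i.2] at h1
    have h2 := hr _ _ (hΦ _ (hclub i (lt_trans i.1.2 hlt))).2.1 y
    exact (hr _ _ (hanti _ _ hij) y).trans_lt (lt_of_le_of_ne h2 h1)
  obtain ⟨f, hf⟩ : ∃ f : ℕ → x ⁻¹' {y}, StrictMono f := by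
    rcases exists_increasing_or_nonincreasing_subseq (· < ·) (Infinite.natEmbedding (x ⁻¹' {y}))
      with ⟨g, hg | hg⟩
    · exact ⟨_, strictMono_nat_of_lt_succ fun n ↦ hg n (n + 1) (Nat.lt_succ_self n)⟩
    · exact absurd (strictAnti_nat_of_succ_lt (f := (Infinite.natEmbedding (x ⁻¹' {y})) ∘ g)
        fun n ↦ lt_of_le_of_ne (not_lt.1 (hg n (n + 1) (Nat.lt_succ_self n)))
          fun h ↦ by simpa using g.injective ((Infinite.natEmbedding _).injective h))
        (not_strictAnti_of_wellFoundedLT _)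
  exact not_strictAnti_of_wellFoundedLT (fun n ↦ r (F (f n)) y) fun m n hmn ↦ hdec _ _ (hf hmn)

/-! ### Cofinal sequences and coherent filtrations -/

theorem exists_cofinal_sequence (o : Ordinal.{u}) :
    ∃ s : Ordinal.{u} → Ordinal.{u}, (∀ j k, j < k → k < o.cof.ord → s j < s k) ∧
      (∀ k < o.cof.ord, s k < o) ∧ ∀ x < o, ∃ k < o.cof.ord, x ≤ s k := by
  obtain ⟨f, hf⟩ := Ordinal.exists_isFundamentalSeq (o := o) rfl
  classical
  refine ⟨fun k ↦ if h : k < o.cof.ord then f ⟨k, h⟩ else 0, fun j k hjk hk ↦ ?_, fun k hk ↦ ?_,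
    fun x hx ↦ ?_⟩
  · simp only [hk, hjk.trans hk, dif_pos]
    exact hf.strictMono (show (⟨j, hjk.trans hk⟩ : Iio o.cof.ord) < ⟨k, hk⟩ from hjk)
  · simp only [hk, dif_pos]
    exact (f ⟨k, hk⟩).2
  · obtain ⟨_, ⟨k, rfl⟩, hk⟩ := hf.isCofinal_range ⟨x, hx⟩
    refine ⟨k, k.2, ?_⟩
    simp only [show (k : Ordinal) < o.cof.ord from k.2, dif_pos]
    exact hk

/-- For regular `mu`, each ordinal `β` less than the successor of `mu` is an increasing union of
sets `a β i`, for `i < mu`, which have fewer than `mu` members and cohere. -/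
theorem exists_coherent_filtration {mu : Cardinal.{u}} (hmu : mu.IsRegular) :
    ∃ a : Ordinal.{u} → Ordinal.{u} → Set Ordinal.{u},
      (∀ β i, a β i ⊆ Iio β) ∧ (∀ β i j, i ≤ j → a β i ⊆ a β j) ∧
      (∀ β < (Order.succ mu).ord, ∀ x < β, ∃ i < mu.ord, x ∈ a β i) ∧
      (∀ β, ∀ i < mu.ord, #(a β i) < Cardinal.lift.{u + 1} mu) ∧
      ∀ β i, ∀ x ∈ a β i, a β i ∩ Iio x = a x i := by
  choose s hs1 hs2 hs3 using exists_cofinal_sequence.{u}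
  -- The cofinal sequence of β is followed only up to those k ≤ i for which its terms already belong
  -- to each other's `i`-th sets. For such k the sets {s β k} ∪ a (s β k) i increase with k, which
  -- is what gives coherence.
  obtain ⟨a, ha⟩ := exists_recursion
    fun β (g : Ordinal.{u} → Ordinal.{u} → Set Ordinal.{u}) i ↦
      {x | ∃ k, k < β.cof.ord ∧ k ≤ i ∧ (∀ m ≤ k, ∀ l < m, s β l ∈ g (s β m) i) ∧
        (x = s β k ∨ x ∈ g (s β k) i)}
  have ha : ∀ β i x, x ∈ a β i ↔ ∃ k, k < β.cof.ord ∧ k ≤ i ∧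
      (∀ m ≤ k, ∀ l < m, s β l ∈ a (s β m) i) ∧ (x = s β k ∨ x ∈ a (s β k) i) := by
    intro β i x
    obtain ⟨g, hg, h⟩ := ha β
    rw [h]
    refine exists_congr fun k ↦ and_congr_right fun hk ↦ and_congr_right fun _ ↦ ?_
    rw [hg _ (hs2 _ _ hk)]
    refine and_congr_left fun _ ↦ forall₂_congr fun m hm ↦ ?_
    rw [hg _ (hs2 _ _ (hm.trans_lt hk))]
  have hsub : ∀ β i, a β i ⊆ Iio β := by
    intro β
    induction β using WellFoundedLT.induction with
    | ind β ih =>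
      intro i x hx
      obtain ⟨k, hk, -, -, rfl | hx⟩ := (ha _ _ _).1 hx
      · exact hs2 _ _ hk
      · exact lt_trans (ih _ (hs2 _ _ hk) _ hx) (hs2 _ _ hk)
  have hmono : ∀ β i j, i ≤ j → a β i ⊆ a β j := by
    intro β
    induction β using WellFoundedLT.induction with
    | ind β ih =>
      intro i j hij x hx
      obtain ⟨k, hk, hki, hJ, hx⟩ := (ha _ _ _).1 hx
      exact (ha _ _ _).2 ⟨k, hk, hki.trans hij,
        fun m hm l hl ↦ ih _ (hs2 _ _ (hm.trans_lt hk)) _ _ hij (hJ m hm l hl),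
        hx.imp_right fun hx ↦ ih _ (hs2 _ _ hk) _ _ hij hx⟩
  refine ⟨a, hsub, hmono, fun β ↦ ?_, fun β ↦ ?_, fun β ↦ ?_⟩
  · induction β using WellFoundedLT.induction with
    | ind β ih =>
      intro hβ x hx
      have hcof : β.cof.ord ≤ mu.ord := by
        rw [ord_le_ord]
        exact (Ordinal.cof_le_card β).trans (Order.lt_succ_iff.1 (lt_ord.1 hβ))
      obtain ⟨k, hk, hxk⟩ := hs3 β x hx
      have hlt : ∀ m < β.cof.ord, s β m < (Order.succ mu).ord := fun m hm ↦ (hs2 _ _ hm).trans hβ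
      have h1 : ∀ y, ∃ i < mu.ord, y < s β k → y ∈ a (s β k) i := fun y ↦ by
        by_cases hy : y < s β k
        · obtain ⟨i, hi, h⟩ := ih _ (hs2 _ _ hk) (hlt k hk) y hy
          exact ⟨i, hi, fun _ ↦ h⟩
        · exact ⟨0, hmu.ord_pos, fun h ↦ absurd h hy⟩
      have h2 : ∀ q : Iio (Order.succ k) × Iio (Order.succ k), ∃ i < mu.ord,
          q.1 < q.2 → s β q.1 ∈ a (s β q.2) i := fun q ↦ by
        by_cases hq : q.1 < q.2
        · have hq2 : (q.2 : Ordinal) < β.cof.ord := (Order.lt_succ_iff.1 q.2.2).trans_lt hk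
          obtain ⟨i, hi, h⟩ := ih _ (hs2 _ _ hq2) (hlt _ hq2) _ (hs1 β _ _ hq hq2)
          exact ⟨i, hi, fun _ ↦ h⟩
        · exact ⟨0, hmu.ord_pos, fun h ↦ absurd h hq⟩
      obtain ⟨i, hi, hi'⟩ := h1 x
      choose f hf hf' using h2
      have hIio := mk_Iio_lt ((isSuccLimit_ord hmu.aleph0_le).succ_lt (hk.trans_le hcof))
      obtain ⟨b, hb, hfb⟩ := exists_bound hmu (by
        rw [← mul_def]
        exact mul_lt_of_lt (aleph0_le_lift.2 hmu.aleph0_le) hIio hIio) hf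
      refine ⟨max (max i b) k, max_lt (max_lt hi hb) (hk.trans_le hcof), (ha _ _ _).2
        ⟨k, hk, le_max_right _ _, fun m hm l hl ↦ ?_, ?_⟩⟩
      · exact hmono _ _ _ ((hfb _).trans ((le_max_right _ _).trans (le_max_left _ _)))
          (hf' (⟨l, Order.lt_succ_iff.2 (hl.le.trans hm)⟩, ⟨m, Order.lt_succ_iff.2 hm⟩) hl)
      · rcases hxk.eq_or_lt with h | h
        · exact Or.inl h
        · exact Or.inr (hmono _ _ _ ((le_max_left _ _).trans (le_max_left _ _)) (hi' h))
  · induction β using WellFoundedLT.induction with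
    | ind β ih =>
      intro i hi
      have hsub : a β i ⊆ ⋃ k : {k : Iio (Order.succ i) // (k : Ordinal) < β.cof.ord},
          ({s β k} ∪ a (s β k) i) := fun x hx ↦ by
        obtain ⟨k, hk, hki, -, hx⟩ := (ha _ _ _).1 hx
        exact mem_iUnion.2 ⟨⟨⟨k, Order.lt_succ_iff.2 hki⟩, hk⟩, hx⟩
      refine (mk_le_mk_of_subset hsub).trans_lt ?_
      have hreg : (Cardinal.lift.{u + 1} mu).IsRegular := hmu.lift
      refine (card_iUnion_lt_iff_forall_of_isRegular hreg ?_).2 fun k ↦ ?_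
      · exact (mk_subtype_le _).trans_lt
          (mk_Iio_lt ((isSuccLimit_ord hmu.aleph0_le).succ_lt hi))
      · refine (mk_union_le _ _).trans_lt (add_lt_of_lt hreg.aleph0_le ?_ (ih _ (hs2 _ _ k.2) i hi))
        rw [mk_singleton]
        exact one_lt_aleph0.trans_le hreg.aleph0_le
  · induction β using WellFoundedLT.induction with
    | ind β ih =>
      intro i x hx
      have key : ∀ k m, m < β.cof.ord → k ≤ m → (∀ m' ≤ m, ∀ l < m', s β l ∈ a (s β m') i) →
          ∀ y, y = s β k ∨ y ∈ a (s β k) i → y = s β m ∨ y ∈ a (s β m) i := by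
        intro k m hm hkm hJ y hy
        rcases hkm.eq_or_lt with rfl | hkm
        · exact hy
        · have h := hJ m le_rfl k hkm
          refine Or.inr ?_
          rcases hy with rfl | hy
          · exact h
          · rw [← ih _ (hs2 _ _ hm) i _ h] at hy
            exact hy.1
      obtain ⟨k, hk, hki, hJ, hx⟩ := (ha _ _ _).1 hx
      ext y
      refine ⟨fun ⟨hy, hyx⟩ ↦ ?_, fun hy ↦ ⟨?_, hsub _ _ hy⟩⟩
      · obtain ⟨k', hk', -, hJ', hy⟩ := (ha _ _ _).1 hy
        obtain ⟨m, hm, hx, hy⟩ : ∃ m < β.cof.ord, (x = s β m ∨ x ∈ a (s β m) i) ∧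
            (y = s β m ∨ y ∈ a (s β m) i) := by
          rcases le_total k k' with h | h
          · exact ⟨k', hk', key _ _ hk' h hJ' _ hx, hy⟩
          · exact ⟨k, hk, hx, key _ _ hk h hJ _ hy⟩
        rcases hx with rfl | hx
        · exact hy.resolve_left (ne_of_lt hyx)
        · rw [← ih _ (hs2 _ _ hm) i _ hx]
          refine ⟨hy.resolve_left ?_, hyx⟩
          rintro rfl
          exact lt_asymm (mem_Iio.1 hyx) (mem_Iio.1 (hsub _ _ hx))
      · refine (ha _ _ _).2 ⟨k, hk, hki, hJ, Or.inr ?_⟩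
        rcases hx with rfl | hx
        · exact hy
        · rw [← ih _ (hs2 _ _ hk) i _ hx] at hy
          exact hy.1

/-! ### Guess systems on the successor of a regular cardinal -/

/-- `c` is strictly increasing and continuous on the ordinals less than `δ`. -/
structure NormalOn (c : Ordinal.{u} → Ordinal.{u}) (δ : Ordinal.{u}) : Prop where
  lt : ∀ i j, i < j → j < δ → c i < c j
  exists_lt : ∀ i < δ, Order.IsSuccLimit i → ∀ x < c i, ∃ j < i, x < c j

/-- The families `P β` have fewer than `lam` members, and every club of `lam` includes the range
of a continuous increasing sequence of length `δ`, such that the set of predecessors in the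
sequence of any of its non-limit members `β` belongs to `P β`. -/
structure GuessSystem (lam : Cardinal.{u}) (δ : Ordinal.{u})
    (P : Ordinal.{u} → Set (Set Ordinal.{u})) : Prop where
  mk_lt : ∀ β < lam.ord, #(P β) < Cardinal.lift.{u + 1} lam
  exists_seq : ∀ E, IsClubIn E lam.ord → ∃ c, NormalOn c δ ∧ (∀ i < δ, c i ∈ E) ∧
    ∀ i < δ, ¬ Order.IsSuccLimit i → c '' Iio i ∈ P (c i)

theorem IsClubIn.closure_subset {E X : Set Ordinal.{u}} {o : Ordinal.{u}} (hE : IsClubIn E o)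
    (hX : X ⊆ E) {x : Ordinal.{u}} (hx : x ∈ closure X) (hxo : x < o) : x ∈ E := by
  obtain ⟨h0, hsup⟩ := ((Ordinal.mem_closure_tfae x X).out 0 2).1 hx
  by_cases hxX : x ∈ X
  · exact hX hxX
  refine (isClubIn_iff.1 hE).2.2 x hxo ?_ fun y hy ↦ ?_
  · rintro rfl
    obtain ⟨y, hy, hy0⟩ := h0
    obtain rfl : y = 0 := le_antisymm hy0 zero_le
    exact hxX hy
  · rw [← hsup] at hy
    obtain ⟨z, hz, hyz⟩ := exists_lt_of_lt_csSup h0 hy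
    exact ⟨z, hX hz.1, hyz, hz.2⟩

theorem IsClubIn.exists_isGreatest {E : Set Ordinal.{u}} {o x : Ordinal.{u}} (hE : IsClubIn E o)
    (hx : x < o) (h : (E ∩ Iic x).Nonempty) : ∃ y, IsGreatest (E ∩ Iic x) y := by
  have hb : BddAbove (E ∩ Iic x) := ⟨x, fun y hy ↦ hy.2⟩
  have hle : sSup (E ∩ Iic x) ≤ x := csSup_le h fun y hy ↦ hy.2
  exact ⟨_, ⟨hE.closure_subset inter_subset_left (csSup_mem_closure h hb) (hle.trans_lt hx), hle⟩,
    fun y hy ↦ le_csSup hb hy⟩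

/-- The strict supremum of the members of `E` that are at most `x`. -/
noncomputable def supBelow (E : Set Ordinal.{u}) (x : Ordinal.{u}) : Ordinal.{u} :=
  sSup (Order.succ '' (E ∩ Iic x))

theorem bddAbove_succ_image (E : Set Ordinal.{u}) (x : Ordinal.{u}) :
    BddAbove (Order.succ '' (E ∩ Iic x)) :=
  ⟨Order.succ x, by rintro _ ⟨y, hy, rfl⟩; exact Order.succ_le_succ hy.2⟩

theorem supBelow_mono {E E' : Set Ordinal.{u}} (h : E' ⊆ E) (x : Ordinal.{u}) :
    supBelow E' x ≤ supBelow E x :=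
  csSup_le_csSup' (bddAbove_succ_image E x) (image_mono (inter_subset_inter_left _ h))

theorem supBelow_eq {E : Set Ordinal.{u}} {x y : Ordinal.{u}} (h : IsGreatest (E ∩ Iic x) y) :
    supBelow E x = Order.succ y :=
  IsGreatest.csSup_eq ⟨mem_image_of_mem _ h.1, by
    rintro _ ⟨z, hz, rfl⟩
    exact Order.succ_le_succ (h.2 hz)⟩

/-- The successors in `supBelow` distinguish an empty set from one with maximum 0. Hence equal
values for two clubs force equal maxima, and a projection to one club lies in the other. -/
theorem mem_of_supBelow_eq {E : Set Ordinal.{u}} {o x y : Ordinal.{u}} (hE : IsClubIn E o)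
    (hx : x < o) (h : supBelow E x = Order.succ y) : y ∈ E := by
  rcases (E ∩ Iic x).eq_empty_or_nonempty with h0 | h0
  · rw [supBelow, h0, image_empty, csSup_empty] at h
    exact absurd h.symm (Order.bot_lt_succ y).ne'
  · obtain ⟨z, hz⟩ := hE.exists_isGreatest hx h0
    rw [supBelow_eq hz] at h
    rw [← Order.succ_injective h]
    exact hz.1.1

/-- Adding a final segment makes `Ordinal.enumOrd` applicable to bounded sets. -/
theorem not_bddAbove_union_Ici (X : Set Ordinal.{u}) (o : Ordinal.{u}) :
    ¬ BddAbove (X ∪ Ici o) := by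
  rintro ⟨b, hb⟩
  have h : o ≤ Order.succ (max b o) := (le_max_right b o).trans (Order.le_succ _)
  exact (Order.lt_succ (max b o)).not_ge ((hb (Or.inr h)).trans (le_max_left b o))

theorem IsClubIn.enumOrd_mem {c : Cardinal.{u}} (hc : c.IsRegular) {E : Set Ordinal.{u}}
    (hE : IsClubIn E c.ord) {j : Ordinal.{u}} (hj : j < c.ord) :
    Ordinal.enumOrd (E ∪ Ici c.ord) j ∈ E := by
  suffices h : Ordinal.enumOrd (E ∪ Ici c.ord) j < c.ord from
    (Ordinal.enumOrd_mem (not_bddAbove_union_Ici E c.ord) j).resolve_right (not_le.2 h)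
  induction j using WellFoundedLT.induction with
  | ind j ih =>
    obtain ⟨b, hb, hb'⟩ := exists_bound hc (mk_Iio_lt hj)
      (f := fun l : Iio j ↦ Ordinal.enumOrd (E ∪ Ici c.ord) l) fun l ↦ ih l l.2 (lt_trans l.2 hj)
    obtain ⟨y, hy, hby⟩ := hE.exists_gt hc.aleph0_le hb
    exact (Ordinal.enumOrd_le_of_forall_lt (Or.inl hy)
      fun l hl ↦ (hb' ⟨l, hl⟩).trans_lt hby).trans_lt (hE.1 hy)

theorem isNormal_enumOrd_closure (X : Set Ordinal.{u}) (o : Ordinal.{u}) :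
    Order.IsNormal (Ordinal.enumOrd (closure X ∪ Ici o)) := by
  refine Ordinal.isNormal_enumOrd (fun t ht h0 hb ↦ ?_) (not_bddAbove_union_Ici _ _)
  exact closure_minimal ht (isClosed_closure.union isClosed_Ici) (csSup_mem_closure h0 hb)

theorem exists_guessSystem_of_isRegular {mu : Cardinal.{u}} (hmu : mu.IsRegular)
    {δ : Ordinal.{u}} (hδ : δ.card < mu) : ∃ P, GuessSystem (Order.succ mu) δ P := by
  have hreg := isRegular_succ hmu.aleph0_le
  have hunc : ℵ₀ < Order.succ mu := hmu.aleph0_le.trans_lt (Order.lt_succ mu)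
  obtain ⟨a, ha1, ha2, ha3, ha4, ha5⟩ := exists_coherent_filtration hmu
  set lam := Order.succ mu
  have hδmu : δ < mu.ord := lt_ord.2 hδ
  have hmulam : mu.ord < lam.ord := ord_lt_ord.2 (Order.lt_succ mu)
  have hδlam : δ < lam.ord := hδmu.trans hmulam
  obtain ⟨E', hE', hstab⟩ := exists_stable hmu.aleph0_le (ι := Ordinal.{u} × Iio mu.ord)
    (r := supBelow) (fun _ _ h ↦ supBelow_mono h) (A := fun s ↦ a s.1 s.2)
    (fun s ↦ ha4 _ _ s.2.2)
    (G := fun s E ↦ s.1 < lam.ord ∧ ∃ e : Ordinal.{u} → Ordinal.{u},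
      (∀ i j, i < j → j < δ → e i < e j) ∧ ∀ j < δ, e j ∈ a s.1 s.2 ∩ E)
    (fun s E E' h ⟨h1, e, h2, h3⟩ ↦ ⟨h1, e, h2, fun j hj ↦ ⟨(h3 j hj).1, h (h3 j hj).2⟩⟩)
    (fun E hE ↦ by
      have he : ∀ j < δ, Ordinal.enumOrd (E ∪ Ici lam.ord) j ∈ E :=
        fun j hj ↦ hE.enumOrd_mem hreg (hj.trans hδlam)
      obtain ⟨γ, hγ, hγ'⟩ := exists_bound hreg (mk_Iio_lt hδlam)
        (f := fun j : Iio δ ↦ Ordinal.enumOrd (E ∪ Ici lam.ord) j) fun j ↦ hE.1 (he j j.2)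
      have hγs := (isSuccLimit_ord hreg.aleph0_le).succ_lt hγ
      choose i hi hi' using fun j : Iio δ ↦ ha3 _ hγs _ (Order.lt_succ_iff.2 (hγ' j))
      obtain ⟨b, hb, hb'⟩ := exists_bound hmu (mk_Iio_lt hδmu) hi
      exact ⟨(Order.succ γ, ⟨b, hb⟩), hγs, _,
        fun i j hij _ ↦ Ordinal.enumOrd_strictMono (not_bddAbove_union_Ici _ _) hij,
        fun j hj ↦ ⟨ha2 _ _ _ (hb' ⟨j, hj⟩) (hi' ⟨j, hj⟩), he j hj⟩⟩)
  let X : Ordinal.{u} → Ordinal.{u} → Set Ordinal.{u} :=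
    fun γ i ↦ {y | ∃ x ∈ a γ i, IsGreatest (E' ∩ Iic x) y}
  refine ⟨fun β ↦ {Q | ∃ x i, i < mu.ord ∧ IsGreatest (E' ∩ Iic x) β ∧
    Q = closure (X x i) ∩ Iio β}, fun β hβ ↦ ?_, fun E₀ hE₀ ↦ ?_⟩
  -- Any x that projects to β lies below every member z of E' above β, so at most |z| · `mu` pairs
  -- (x, i) matter.
  · obtain ⟨z, hz, hβz⟩ := hE'.exists_gt hreg.aleph0_le hβ
    have hsub : {Q | ∃ x i, i < mu.ord ∧ IsGreatest (E' ∩ Iic x) β ∧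
        Q = closure (X x i) ∩ Iio β} ⊆
        range fun q : Iio z × Iio mu.ord ↦ closure (X q.1 q.2) ∩ Iio β := by
      rintro _ ⟨x, i, hi, hx, rfl⟩
      exact ⟨(⟨x, mem_Iio.2 (lt_of_not_ge fun h ↦ hβz.not_ge (hx.2 ⟨hz, h⟩))⟩, ⟨i, hi⟩), rfl⟩
    refine ((mk_le_mk_of_subset hsub).trans mk_range_le).trans_lt ?_
    rw [← mul_def]
    exact mul_lt_of_lt (aleph0_le_lift.2 hreg.aleph0_le) (mk_Iio_lt (hE'.1 hz)) (mk_Iio_lt hmulam)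
  obtain ⟨⟨γ, i, hi⟩, ⟨hγ, e, he, hea⟩, hstab⟩ :=
    hstab _ (hE₀.inter hreg hunc hE') inter_subset_right
  simp only at hγ hea hstab
  have hE := hE₀.inter hreg hunc hE'
  have hXE : X γ i ⊆ E₀ ∩ E' := by
    rintro y ⟨x, hx, hxy⟩
    refine mem_of_supBelow_eq hE ((ha1 _ _ hx).trans hγ) ?_
    rw [hstab x hx, supBelow_eq hxy]
  have heX : ∀ j < δ, e j ∈ X γ i := fun j hj ↦
    ⟨e j, (hea j hj).1, ⟨(hea j hj).2.2, mem_Iic.2 le_rfl⟩, fun y hy ↦ hy.2⟩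
  have hc := isNormal_enumOrd_closure (X γ i) lam.ord
  have hcV := Ordinal.enumOrd_mem (not_bddAbove_union_Ici (closure (X γ i)) lam.ord)
  have hcsurj : ∀ x ∈ closure (X γ i), ∃ l, Ordinal.enumOrd (closure (X γ i) ∪ Ici lam.ord) l = x :=
    fun x hx ↦ Ordinal.enumOrd_surjective (not_bddAbove_union_Ici _ _) (Or.inl hx)
  have hce : ∀ j < δ, Ordinal.enumOrd (closure (X γ i) ∪ Ici lam.ord) j ≤ e j := by
    intro j
    induction j using WellFoundedLT.induction with
    | ind j ih =>
      intro hj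
      exact Ordinal.enumOrd_le_of_forall_lt (Or.inl (subset_closure (heX j hj)))
        fun l hl ↦ (ih l hl (hl.trans hj)).trans_lt (he _ _ hl hj)
  set c := Ordinal.enumOrd (closure (X γ i) ∪ Ici lam.ord)
  have hclam : ∀ j < δ, c j < lam.ord := fun j hj ↦ (hce j hj).trans_lt (hE.1 (hXE (heX j hj)))
  have hcX : ∀ j < δ, c j ∈ closure (X γ i) := fun j hj ↦ (hcV j).resolve_right
    (not_le.2 (hclam j hj))
  refine ⟨c, ⟨fun _ _ h _ ↦ hc.strictMono h, fun j _ hj x hx ↦ (hc.lt_iff_exists_lt hj).1 hx⟩,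
    fun j hj ↦ (hE.closure_subset hXE (hcX j hj) (hclam j hj)).1, fun j hj hjlim ↦ ?_⟩
  -- At a non-limit index the closure contributes no new point, so `c j` is itself a projection.
  have hmem : c j ∈ X γ i := by
    by_contra hmem
    obtain ⟨h0, hsup⟩ := ((Ordinal.mem_closure_tfae (c j) (X γ i)).out 0 2).1 (hcX j hj)
    have hlt : ∀ y ∈ X γ i ∩ Iic (c j), ∃ l < j, c l = y := by
      rintro y ⟨hy, hyj⟩
      obtain ⟨l, rfl⟩ := hcsurj y (subset_closure hy)
      refine ⟨l, lt_of_le_of_ne (hc.strictMono.le_iff_le.1 hyj) ?_, rfl⟩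
      rintro rfl
      exact hmem hy
    rcases Ordinal.zero_or_succ_or_isSuccLimit j with rfl | ⟨l, rfl⟩ | h
    · obtain ⟨y, hy⟩ := h0
      obtain ⟨l, hl, -⟩ := hlt y hy
      exact not_lt_zero hl
    · refine (hc.strictMono (Order.lt_succ l)).not_ge ?_
      rw [← hsup]
      refine csSup_le h0 fun y hy ↦ ?_
      obtain ⟨k, hk, rfl⟩ := hlt y hy
      exact hc.strictMono.monotone (Order.lt_succ_iff.1 hk)
    · exact hjlim h
  -- With x least, the members of `a γ i` below x are exactly those projecting below `c j`. As `a γ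
  -- i ∩ Iio x = a x i`, the segment depends on (x, i) and no longer on γ.
  obtain ⟨x, ⟨hx, hxc⟩, hmin⟩ := WellFounded.has_min (wellFounded_lt (α := Ordinal.{u}))
    {x | x ∈ a γ i ∧ IsGreatest (E' ∩ Iic x) (c j)} hmem
  refine ⟨x, i, hi, hxc, ?_⟩
  have hX' : X x i = X γ i ∩ Iio (c j) := by
    ext y
    simp only [X, mem_inter_iff, mem_ofPred_eq, mem_Iio, ← ha5 γ i x hx]
    constructor
    · rintro ⟨z, ⟨hz, hzx⟩, hzy⟩
      refine ⟨⟨z, hz, hzy⟩, lt_of_le_of_ne (hxc.2 ⟨hzy.1.1, hzy.1.2.trans (le_of_lt hzx)⟩) ?_⟩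
      rintro rfl
      exact hmin z ⟨hz, hzy⟩ hzx
    · rintro ⟨⟨z, hz, hzy⟩, hyj⟩
      refine ⟨z, ⟨hz, lt_of_not_ge fun hxz ↦ hyj.not_ge ?_⟩, hzy⟩
      exact hzy.2 ⟨hxc.1.1, hxc.1.2.trans hxz⟩
  ext y
  constructor
  · rintro ⟨l, hl, rfl⟩
    refine ⟨?_, hc.strictMono hl⟩
    rw [hX', inter_comm]
    exact isOpen_Iio.inter_closure ⟨hc.strictMono hl, hcX l (lt_trans hl hj)⟩
  · rintro ⟨hy, hyj⟩
    rw [hX'] at hy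
    obtain ⟨l, rfl⟩ := hcsurj y (closure_mono inter_subset_left hy)
    exact ⟨l, hc.strictMono.lt_iff_lt.1 hyj, rfl⟩

/-! ### Lifting guess systems to larger cardinals -/

theorem NormalOn.le {c : Ordinal.{u} → Ordinal.{u}} {δ i j : Ordinal.{u}} (hc : NormalOn c δ)
    (hij : i ≤ j) (hj : j < δ) : c i ≤ c j := by
  rcases hij.eq_or_lt with rfl | h
  · exact le_rfl
  · exact (hc.lt _ _ h hj).le

theorem NormalOn.lt_iff {c : Ordinal.{u} → Ordinal.{u}} {δ i j : Ordinal.{u}} (hc : NormalOn c δ)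
    (hi : i < δ) (hj : j < δ) : c i < c j ↔ i < j :=
  ⟨fun h ↦ lt_of_not_ge fun h' ↦ h.not_ge (hc.le h' hi), fun h ↦ hc.lt _ _ h hj⟩

theorem NormalOn.comp {f c : Ordinal.{u} → Ordinal.{u}} {σ δ : Ordinal.{u}} (hf : NormalOn f σ)
    (hc : NormalOn c δ) (h : ∀ i < δ, c i < σ) : NormalOn (f ∘ c) δ := by
  refine ⟨fun i j hij hj ↦ hf.lt _ _ (hc.lt _ _ hij hj) (h j hj), fun i hi hlim x hx ↦ ?_⟩
  have hlim' : Order.IsSuccLimit (c i) := by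
    refine ⟨not_isMin_iff.2 ⟨c 0, hc.lt _ _ hlim.bot_lt hi⟩, fun y hy ↦ ?_⟩
    obtain ⟨j, hj, hyj⟩ := hc.exists_lt i hi hlim y hy.lt
    exact hy.2 hyj (hc.lt _ _ hj hi)
  obtain ⟨y, hy, hxy⟩ := hf.exists_lt _ (h i hi) hlim' x hx
  obtain ⟨j, hj, hyj⟩ := hc.exists_lt i hi hlim y hy
  exact ⟨j, hj, hxy.trans (hf.lt _ _ hyj (h j (hj.trans hi)))⟩

/-- After ω steps of interleaving, both sequences have the same supremum, and continuity makes them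
equal at the limit index, which is below σ because σ is regular and uncountable. -/
theorem isClubIn_eqOn {σ : Cardinal.{u}} (hσ : σ.IsRegular) (hσ' : ℵ₀ < σ)
    {f g : Ordinal.{u} → Ordinal.{u}} (hf : NormalOn f σ.ord) (hg : NormalOn g σ.ord)
    (hfg : ∀ i < σ.ord, ∃ j < σ.ord, f i < g j) (hgf : ∀ i < σ.ord, ∃ j < σ.ord, g i < f j) :
    IsClubIn {i | i < σ.ord ∧ f i = g i} σ.ord := by
  have hlim := isSuccLimit_ord hσ.aleph0_le
  have h1 : ∀ i, ∃ j, i < σ.ord → j < σ.ord ∧ i < j ∧ f i < g j ∧ g i < f j := fun i ↦ by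
    by_cases hi : i < σ.ord
    · obtain ⟨j, hj, hij⟩ := hfg i hi
      obtain ⟨k, hk, hik⟩ := hgf i hi
      have hm : max (Order.succ i) (max j k) < σ.ord := max_lt (hlim.succ_lt hi) (max_lt hj hk)
      exact ⟨max (Order.succ i) (max j k), fun _ ↦ ⟨hm,
        (Order.lt_succ i).trans_le (le_max_left _ _),
        hij.trans_le (hg.le ((le_max_left _ _).trans (le_max_right _ _)) hm),
        hik.trans_le (hf.le ((le_max_right _ _).trans (le_max_right _ _)) hm)⟩⟩
    · exact ⟨0, fun h ↦ absurd h hi⟩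
  choose h hh using h1
  refine isClubIn_iff.2 ⟨fun i hi ↦ hi.1, fun x hx ↦ ?_, fun x hx hx0 hacc ↦ ?_⟩
  · have hn : ∀ n : ℕ, h^[n] x < σ.ord := fun n ↦ by
      induction n with
      | zero => exact hx
      | succ n ih =>
        rw [Function.iterate_succ_apply']
        exact (hh _ ih).1
    have hstep : ∀ n : ℕ, h^[n] x < h^[n + 1] x ∧ f (h^[n] x) < g (h^[n + 1] x) ∧
        g (h^[n] x) < f (h^[n + 1] x) := fun n ↦ by
      rw [Function.iterate_succ_apply']
      exact (hh _ (hn n)).2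
    let y := ⨆ n : ℕ, h^[n] x
    have hy : y < σ.ord := Ordinal.lift_iSup_lt_of_lt_cof (by
      rw [← Ordinal.lift_cof, hσ.cof_ord]
      simpa using hσ') hn
    have hle : ∀ n, h^[n] x ≤ y := fun n ↦ le_ciSup (f := fun n : ℕ ↦ h^[n] x) 
      ⟨σ.ord, by rintro _ ⟨m, rfl⟩; exact (hn m).le⟩ n
    have hlt : ∀ n, h^[n] x < y := fun n ↦ (hstep n).1.trans_le (hle _)
    have hex : ∀ z < y, ∃ n, z < h^[n] x := fun z hz ↦ (Ordinal.lt_iSup_iff).1 hz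
    have hylim : Order.IsSuccLimit y := by
      refine ⟨not_isMin_iff.2 ⟨_, hlt 0⟩, fun z hz ↦ ?_⟩
      obtain ⟨n, hn⟩ := hex z hz.lt
      exact hz.2 hn (hlt n)
    refine ⟨y, ⟨hy, le_antisymm (le_of_not_gt fun hlt' ↦ ?_) (le_of_not_gt fun hlt' ↦ ?_)⟩,
      hle 0⟩
    · obtain ⟨j, hj, hj'⟩ := hf.exists_lt y hy hylim _ hlt'
      obtain ⟨n, hn'⟩ := hex j hj
      exact lt_irrefl _ (hj'.trans ((hf.lt _ _ hn' (hn n)).trans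
        ((hstep n).2.1.trans (hg.lt _ _ (hlt _) hy))))
    · obtain ⟨j, hj, hj'⟩ := hg.exists_lt y hy hylim _ hlt'
      obtain ⟨n, hn'⟩ := hex j hj
      exact lt_irrefl _ (hj'.trans ((hg.lt _ _ hn' (hn n)).trans
        ((hstep n).2.2.trans (hf.lt _ _ (hlt _) hy))))
  · by_contra hxD
    have hacc' : ∀ y < x, ∃ z, z < σ.ord ∧ f z = g z ∧ y < z ∧ z < x := fun y hy ↦ by
      obtain ⟨z, hz, hyz, hzx⟩ := hacc y hy
      refine ⟨z, hz.1, hz.2, hyz, lt_of_le_of_ne hzx ?_⟩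
      rintro rfl
      exact hxD hz
    have hxlim : Order.IsSuccLimit x := by
      refine ⟨not_isMin_iff.2 ⟨0, pos_iff_ne_zero.2 hx0⟩, fun y hy ↦ ?_⟩
      obtain ⟨z, -, -, hyz, hzx⟩ := hacc' y hy.lt
      exact hy.2 hyz hzx
    refine hxD ⟨hx, le_antisymm (le_of_not_gt fun hlt' ↦ ?_) (le_of_not_gt fun hlt' ↦ ?_)⟩
    · obtain ⟨j, hj, hj'⟩ := hf.exists_lt x hx hxlim _ hlt'
      obtain ⟨z, hz, hfgz, hjz, hzx⟩ := hacc' j hj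
      exact lt_irrefl _ (hj'.trans ((hf.lt _ _ hjz hz).trans (hfgz ▸ hg.lt _ _ hzx hx)))
    · obtain ⟨j, hj, hj'⟩ := hg.exists_lt x hx hxlim _ hlt'
      obtain ⟨z, hz, hfgz, hjz, hzx⟩ := hacc' j hj
      exact lt_irrefl _ (hj'.trans ((hg.lt _ _ hjz hz).trans (hfgz ▸ hf.lt _ _ hzx hx)))

/-- A sequence through a club which grows faster than a given function of the sets that its
bounded restrictions generate. -/
theorem exists_normalOn_of_index {σ lam : Cardinal.{u}} (hlam : lam.IsRegular)
    (hσlam : σ < lam) (p : Ordinal.{u} → Set Ordinal.{u})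
    {idx : Set Ordinal.{u} → Ordinal.{u}} (hidx : ∀ x, idx x < lam.ord)
    {E : Set Ordinal.{u}} (hE : IsClubIn E lam.ord) :
    ∃ f, NormalOn f σ.ord ∧ (∀ i < σ.ord, f i ∈ E) ∧
      ∀ i < σ.ord, ∀ j < σ.ord, (p j = ∅ ∨ ∃ s < i, p j ⊆ Iic s) → idx (f '' p j) < f i := by
  obtain ⟨f, hf⟩ := exists_recursion fun i (g : Ordinal.{u} → Ordinal.{u}) ↦
    sInf {x | x ∈ E ∧ (∀ l < i, g l < x) ∧
      ∀ j < σ.ord, (p j = ∅ ∨ ∃ s < i, p j ⊆ Iic s) → idx (g '' p j) < x}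
  have hf : ∀ i, f i = sInf {x | x ∈ E ∧ (∀ l < i, f l < x) ∧
      ∀ j < σ.ord, (p j = ∅ ∨ ∃ s < i, p j ⊆ Iic s) → idx (f '' p j) < x} := fun i ↦ by
    obtain ⟨g, hg, h⟩ := hf i
    rw [h]
    congr 1
    ext x
    refine and_congr_right fun _ ↦ and_congr (forall₂_congr fun l hl ↦ by rw [hg l hl])
      (forall₂_congr fun j _ ↦ forall_congr' fun hj ↦ ?_)
    rw [image_congr fun l hl ↦ hg l ?_]
    rcases hj with hj | ⟨s, hs, hj⟩
    · simp [hj] at hl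
    · exact lt_of_le_of_lt (hj hl) hs
  have hord : σ.ord < lam.ord := ord_lt_ord.2 hσlam
  have hmem : ∀ i < σ.ord, f i ∈ E ∧ (∀ l < i, f l < f i) ∧
      ∀ j < σ.ord, (p j = ∅ ∨ ∃ s < i, p j ⊆ Iic s) → idx (f '' p j) < f i := by
    intro i
    induction i using WellFoundedLT.induction with
    | ind i ih =>
      intro hi
      obtain ⟨b, hb, hb'⟩ := exists_bound hlam (mk_Iio_lt (hi.trans hord))
        (f := fun l : Iio i ↦ f l) fun l ↦ hE.1 (ih l l.2 (lt_trans l.2 hi)).1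
      obtain ⟨d, hd, hd'⟩ := exists_bound hlam (mk_Iio_lt hord)
        (f := fun j : Iio σ.ord ↦ idx (f '' p j)) fun j ↦ hidx _
      obtain ⟨y, hy, hby⟩ := hE.exists_gt hlam.aleph0_le (max_lt hb hd)
      have := csInf_mem (s := {x | x ∈ E ∧ (∀ l < i, f l < x) ∧
        ∀ j < σ.ord, (p j = ∅ ∨ ∃ s < i, p j ⊆ Iic s) → idx (f '' p j) < x}) ⟨y, hy,
          fun l hl ↦ (hb' ⟨l, hl⟩).trans_lt ((le_max_left _ _).trans_lt hby),
          fun j hj _ ↦ (hd' ⟨j, hj⟩).trans_lt ((le_max_right _ _).trans_lt hby)⟩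
      rwa [← hf] at this
  refine ⟨f, ⟨fun i j hij hj ↦ (hmem j hj).2.1 i hij, fun i hi hlim x hx ↦ ?_⟩,
    fun i hi ↦ (hmem i hi).1, fun i hi ↦ (hmem i hi).2.2⟩
  -- At a limit `i` the supremum of the earlier values meets every requirement, each having been met
  -- at a successor stage below `i`; so the least choice `f i` does not exceed it.
  by_contra! hcon
  have hb : BddAbove (f '' Iio i) := ⟨x, by rintro _ ⟨j, hj, rfl⟩; exact hcon j hj⟩
  have hne : (f '' Iio i).Nonempty := ⟨_, 0, hlim.bot_lt, rfl⟩
  have hyx : sSup (f '' Iio i) ≤ x := csSup_le hne (by rintro _ ⟨j, hj, rfl⟩; exact hcon j hj)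
  have hylam : sSup (f '' Iio i) < lam.ord := hyx.trans_lt (hx.trans (hE.1 (hmem i hi).1))
  have hlt : ∀ s < i, f (Order.succ s) ≤ sSup (f '' Iio i) := fun s hs ↦
    le_csSup hb ⟨_, hlim.succ_lt hs, rfl⟩
  refine hx.not_ge (le_trans ?_ hyx)
  rw [hf]
  refine csInf_le' ⟨hE.closure_subset ?_ (csSup_mem_closure hne hb) hylam, fun l hl ↦ ?_,
    fun j hj h ↦ ?_⟩
  · rintro _ ⟨j, hj, rfl⟩
    exact (hmem j (lt_trans hj hi)).1
  · exact ((hmem _ ((hlim.succ_lt hl).trans hi)).2.1 l (Order.lt_succ l)).trans_le (hlt l hl)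
  · rcases h with h | ⟨s, hs, h⟩
    · exact ((hmem _ ((hlim.succ_lt hlim.bot_lt).trans hi)).2.2 j hj (Or.inl h)).trans_le
        (hlt _ hlim.bot_lt)
    · exact ((hmem _ ((hlim.succ_lt hs).trans hi)).2.2 j hj
        (Or.inr ⟨s, Order.lt_succ s, h⟩)).trans_le (hlt s hs)

/-- The system on σ is carried along a sequence f of length σ through the given club. The sets f ''
p j depend on f, but f agrees on a club of σ with a sequence e γ fixed in advance for γ = sup f.
Guessing that club turns them into sets e γ '' p j, of which there are at most `lam`; f grows fast
enough to pass their indices in `t`. -/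
theorem GuessSystem.exists_of_lt {σ lam : Cardinal.{u}} (hσ : σ.IsRegular) (hσ' : ℵ₀ < σ)
    (hlam : lam.IsRegular) (hσlam : σ < lam) {δ : Ordinal.{u}}
    {P : Ordinal.{u} → Set (Set Ordinal.{u})} (hP : GuessSystem σ δ P) :
    ∃ P', GuessSystem lam δ P' := by
  have hord : σ.ord < lam.ord := ord_lt_ord.2 hσlam
  obtain ⟨p, hp⟩ : ∃ p : Ordinal.{u} → Set Ordinal.{u},
      (⋃ β : Iio σ.ord, P β) ⊆ p '' Iio σ.ord := by
    refine exists_subset_image_Iio ((mk_iUnion_le_sum_mk).trans ?_)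
    refine (sum_le_sum _ (fun _ ↦ Cardinal.lift.{u + 1} σ) fun β : Iio σ.ord ↦ (hP.mk_lt β β.2).le).trans ?_
    rw [sum_const', mk_Iio_ordinal, card_ord, mul_eq_self (aleph0_le_lift.2 hσ.aleph0_le)]
  let good (γ : Ordinal.{u}) (e : Ordinal.{u} → Ordinal.{u}) : Prop :=
    NormalOn e σ.ord ∧ (∀ i < σ.ord, e i < γ) ∧ ∀ x < γ, ∃ i < σ.ord, x < e i
  have hgood : ∀ γ, ∃ e, (∃ e', good γ e') → good γ e := fun γ ↦ by
    by_cases h : ∃ e', good γ e'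
    · exact ⟨h.choose, fun _ ↦ h.choose_spec⟩
    · exact ⟨id, fun h' ↦ absurd h' h⟩
  choose e he using hgood
  obtain ⟨t, ht⟩ : ∃ t : Ordinal.{u} → Set Ordinal.{u},
      (range fun q : Iio lam.ord × Iio σ.ord ↦ e q.1 '' p q.2) ⊆ t '' Iio lam.ord := by
    refine exists_subset_image_Iio (mk_range_le.trans ?_)
    rw [← mul_def, mk_Iio_ordinal, mk_Iio_ordinal, card_ord, card_ord, ← lift_mul, lift_le]
    exact mul_le_of_le hlam.aleph0_le le_rfl hσlam.le
  have hidx : ∀ x, ∃ η < lam.ord, x ∈ t '' Iio lam.ord → t η = x := fun x ↦ by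
    by_cases h : x ∈ t '' Iio lam.ord
    · obtain ⟨η, hη, h⟩ := h
      exact ⟨η, hη, fun _ ↦ h⟩
    · exact ⟨0, hlam.ord_pos, fun h' ↦ absurd h' h⟩
  choose idx hidx1 hidx2 using hidx
  refine ⟨fun β ↦ t '' Iio β, fun β hβ ↦ mk_image_Iio_lt hβ t, fun E hE ↦ ?_⟩
  obtain ⟨f, hf, hfE, hfidx⟩ := exists_normalOn_of_index hlam hσlam p hidx1 hE
  obtain ⟨b, hb, hb'⟩ := exists_bound hlam (mk_Iio_lt hord) (f := fun i : Iio σ.ord ↦ f i)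
    fun i ↦ hE.1 (hfE i i.2)
  have hlim := isSuccLimit_ord hσ.aleph0_le
  have hne : (f '' Iio σ.ord).Nonempty := ⟨_, 0, hlim.bot_lt, rfl⟩
  have hub : b ∈ upperBounds (f '' Iio σ.ord) := by
    rintro _ ⟨i, hi, rfl⟩
    exact hb' ⟨i, hi⟩
  let γ := sSup (f '' Iio σ.ord)
  have hγ : γ < lam.ord := (csSup_le hne hub).trans_lt hb
  have hfγ : good γ f := by
    refine ⟨hf, fun i hi ↦ ?_, fun x hx ↦ ?_⟩
    · exact (hf.lt _ _ (Order.lt_succ i) (hlim.succ_lt hi)).trans_le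
        (le_csSup ⟨b, hub⟩ ⟨_, hlim.succ_lt hi, rfl⟩)
    · obtain ⟨_, ⟨i, hi, rfl⟩, h⟩ := exists_lt_of_lt_csSup hne hx
      exact ⟨i, hi, h⟩
  obtain ⟨he1, he2, he3⟩ := he γ ⟨f, hfγ⟩
  have hD := isClubIn_eqOn hσ hσ' hf he1 (fun i hi ↦ he3 _ (hfγ.2.1 i hi))
    fun i hi ↦ hfγ.2.2 _ (he2 i hi)
  obtain ⟨c, hc, hcD, hcP⟩ := hP.exists_seq _ hD
  refine ⟨f ∘ c, hf.comp hc fun i hi ↦ (hcD i hi).1, fun i hi ↦ hfE _ (hcD i hi).1,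
    fun i hi hilim ↦ ?_⟩
  obtain ⟨j, hj, hpj⟩ := hp (mem_iUnion.2 ⟨⟨c i, (hcD i hi).1⟩, hcP i hi hilim⟩)
  rw [image_comp, ← hpj]
  have hpe : f '' p j = e γ '' p j := by
    rw [hpj]
    refine image_congr ?_
    rintro _ ⟨l, hl, rfl⟩
    exact (hcD l (lt_trans hl hi)).2
  refine ⟨idx (f '' p j), hfidx _ (hcD i hi).1 j hj ?_, hidx2 _ (ht ?_)⟩
  · rw [hpj]
    -- The empty alternative is needed at index 0, where `c 0` may be 0 and nothing lies below it.
    rcases Ordinal.zero_or_succ_or_isSuccLimit i with rfl | ⟨l, rfl⟩ | h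
    · left
      simp
    · refine Or.inr ⟨c l, hc.lt _ _ (Order.lt_succ l) hi, ?_⟩
      rintro _ ⟨k, hk, rfl⟩
      exact hc.le (Order.lt_succ_iff.1 hk) ((Order.lt_succ l).trans hi)
    · exact absurd h hilim
  · rw [hpe]
    exact ⟨(⟨γ, hγ⟩, ⟨j, hj⟩), rfl⟩

theorem exists_guessSystem {mu : Cardinal.{u}} {δ : Ordinal.{u}} (hinf : ℵ₀ ≤ δ.card)
    (hδ : δ.card < mu) : ∃ P, GuessSystem (Order.succ mu) δ P := by
  have hreg := isRegular_succ hinf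
  rcases (Order.succ_le_of_lt hδ).eq_or_lt with h | h
  · rw [← h]
    exact exists_guessSystem_of_isRegular hreg (Order.lt_succ _)
  · obtain ⟨P, hP⟩ := exists_guessSystem_of_isRegular hreg (Order.lt_succ δ.card)
    exact hP.exists_of_lt (isRegular_succ hreg.aleph0_le)
      (hreg.aleph0_le.trans_lt (Order.lt_succ _)) (isRegular_succ (hinf.trans hδ.le))
      ((Order.succ_le_of_lt h).trans_lt (Order.lt_succ mu))

/-! ### One guessing sequence at each point -/

/-- If cf(o) is smaller, h is bounded along a cofinal sequence of o. If cf(o') is smaller, failure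
at each term of a cofinal sequence of o' gives thresholds with a common bound in o, and h has no
possible value there. -/
theorem exists_cofinal_le {o o' : Ordinal.{u}} (hcof : o.cof ≠ o'.cof)
    {h : Ordinal.{u} → Ordinal.{u}} (hh : ∀ i < o, h i < o') :
    ∃ χ < o', ∀ x < o, ∃ i < o, x ≤ i ∧ h i ≤ χ := by
  by_contra! H
  rcases hcof.lt_or_gt with hlt | hlt
  · obtain ⟨s, -, hs, hs'⟩ := exists_cofinal_sequence o
    obtain ⟨χ, hχ, hχ'⟩ := exists_bound_of_lt_cof (ι := Iio o.cof.ord) (o := o')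
      (by rwa [mk_Iio_ordinal, card_ord, Cardinal.lift_lt])
      (f := fun k : Iio o.cof.ord ↦ h (s k)) fun k ↦ hh _ (hs k k.2)
    obtain ⟨x, hx, hx'⟩ := H χ hχ
    obtain ⟨k, hk, hxk⟩ := hs' x hx
    exact (hx' _ (hs k hk) hxk).not_ge (hχ' ⟨k, hk⟩)
  · obtain ⟨s, -, hs, hs'⟩ := exists_cofinal_sequence o'
    choose b hb hb' using H
    obtain ⟨x, hx, hx'⟩ := exists_bound_of_lt_cof (ι := Iio o'.cof.ord) (o := o)
      (by rwa [mk_Iio_ordinal, card_ord, Cardinal.lift_lt])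
      (f := fun k : Iio o'.cof.ord ↦ b (s k) (hs k k.2)) fun k ↦ hb _ _
    obtain ⟨k, hk, hxk⟩ := hs' _ (hh x hx)
    exact (hb' (s k) (hs k hk) x hx (hx' ⟨k, hk⟩)).not_ge hxk

/-- Otherwise intersect `mu` clubs, one counterexample for each index. -/
theorem exists_uniform_index {mu : Cardinal.{u}} (hmu : ℵ₀ ≤ mu)
    {Q : Ordinal.{u} → Set Ordinal.{u} → Prop} (hQ : ∀ x E E', E' ⊆ E → Q x E' → Q x E)
    (h : ∀ E, IsClubIn E (Order.succ mu).ord → ∃ x < mu.ord, Q x E) :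
    ∃ x < mu.ord, ∀ E, IsClubIn E (Order.succ mu).ord → Q x E := by
  by_contra! H
  choose F hF hF' using H
  obtain ⟨x, hx, hxE⟩ := h _ (isClubIn_forall (isRegular_succ hmu)
    (hmu.trans_lt (Order.lt_succ mu)) (mk_Iio_lt (ord_lt_ord.2 (Order.lt_succ mu)))
    fun x : Iio mu.ord ↦ hF x x.2)
  exact hF' x hx (hQ _ _ _ (fun y hy ↦ hy.2 ⟨x, hx⟩) hxE)

/-- Club guessing by a single sequence `C γ` at each point `γ` of `S`, where the initial segments
of these sequences belong to small families. -/
theorem exists_guess_sequence {mu : Cardinal.{u}} {δ : Ordinal.{u}} (hδ : Order.IsSuccLimit δ)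
    (hcard : δ.card < mu) (hcof : δ.cof ≠ mu.ord.cof) :
    ∃ (S : Set Ordinal.{u}) (C : Ordinal.{u} → Ordinal.{u} → Ordinal.{u})
      (P : Ordinal.{u} → Set (Set Ordinal.{u})),
      (∀ β < (Order.succ mu).ord, #(P β) < Cardinal.lift.{u + 1} (Order.succ mu)) ∧
      (∀ γ ∈ S, γ < (Order.succ mu).ord ∧ NormalOn (C γ) δ ∧ (∀ i < δ, C γ i < γ) ∧
        (∀ x < γ, ∃ i < δ, x < C γ i) ∧
        ∀ i < δ, ¬ Order.IsSuccLimit i → C γ '' Iio i ∈ P (C γ i)) ∧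
      ∀ E, IsClubIn E (Order.succ mu).ord → ∃ γ ∈ S, ∀ i < δ, C γ i ∈ E := by
  have hinf : ℵ₀ ≤ δ.card :=
    Ordinal.aleph0_le_card.2 (Ordinal.omega0_le_of_isSuccLimit hδ)
  have hmu : ℵ₀ ≤ mu := hinf.trans hcard.le
  have hreg := isRegular_succ hmu
  have hunc : ℵ₀ < Order.succ mu := hmu.trans_lt (Order.lt_succ mu)
  obtain ⟨P, hP⟩ := exists_guessSystem hinf hcard
  have hmulim := isSuccLimit_ord hmu
  set lam := Order.succ mu with hlam
  have hδlam : δ < lam.ord := lt_ord.2 (hcard.trans (Order.lt_succ mu))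
  have hp : ∀ β, ∃ p : Ordinal.{u} → Set Ordinal.{u}, β < lam.ord → P β ⊆ p '' Iio mu.ord := by
    intro β
    by_cases hβ : β < lam.ord
    · have := hP.mk_lt β hβ
      rw [hlam, lift_succ, Order.lt_succ_iff] at this
      obtain ⟨p, hp⟩ := exists_subset_image_Iio this
      exact ⟨p, fun _ ↦ hp⟩
    · exact ⟨fun _ ↦ ∅, fun h ↦ absurd h hβ⟩
  choose p hp using hp
  have hf : ∀ γ, ∃ f : Ordinal.{u} → Ordinal.{u}, γ < lam.ord → Iio γ ⊆ f '' Iio mu.ord := by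
    intro γ
    by_cases hγ : γ < lam.ord
    · have := mk_Iio_lt hγ
      rw [hlam, lift_succ, Order.lt_succ_iff] at this
      obtain ⟨f, hf⟩ := exists_subset_image_Iio this
      exact ⟨f, fun _ ↦ hf⟩
    · exact ⟨id, fun h ↦ absurd h hγ⟩
  choose f hf using hf
  classical
  -- The last clause asks that, for cofinally many i, both the point c(i+1) and the segment below it
  -- have index less than χ. Successor indices are used because the system controls only non-limit
  -- ones.
  let good (γ χ : Ordinal.{u}) (c : Ordinal.{u} → Ordinal.{u}) : Prop :=
    (γ < lam.ord ∧ NormalOn c δ ∧ (∀ i < δ, c i < γ) ∧ (∀ x < γ, ∃ i < δ, x < c i) ∧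
      ∀ i < δ, ¬ Order.IsSuccLimit i → c '' Iio i ∈ P (c i)) ∧
    ∀ x < δ, ∃ i < δ, x ≤ i ∧ (∃ ζ < χ, f γ ζ = c (Order.succ i)) ∧
      ∃ ζ < χ, p (c (Order.succ i)) ζ = c '' Iio (Order.succ i)
  have hgood : ∀ E, IsClubIn E lam.ord → ∃ s : Ordinal.{u} × Iio mu.ord,
      ∃ c, good s.1 s.2 c ∧ ∀ i < δ, c i ∈ E := by
    intro E hE
    obtain ⟨c, hc, hcE, hcP⟩ := hP.exists_seq E hE
    obtain ⟨b, hb, hb'⟩ := exists_bound hreg (mk_Iio_lt hδlam) (f := fun i : Iio δ ↦ c i)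
      fun i ↦ hE.1 (hcE i i.2)
    have hne : (c '' Iio δ).Nonempty := ⟨_, 0, hδ.bot_lt, rfl⟩
    have hub : b ∈ upperBounds (c '' Iio δ) := by
      rintro _ ⟨i, hi, rfl⟩
      exact hb' ⟨i, hi⟩
    have hγ : sSup (c '' Iio δ) < lam.ord := (csSup_le hne hub).trans_lt hb
    have hcγ : ∀ i < δ, c i < sSup (c '' Iio δ) := fun i hi ↦
      (hc.lt _ _ (Order.lt_succ i) (hδ.succ_lt hi)).trans_le
        (le_csSup ⟨b, hub⟩ ⟨_, hδ.succ_lt hi, rfl⟩)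
    set γ := sSup (c '' Iio δ)
    have hidx : ∀ i, ∃ ζ < mu.ord, i < δ → f γ ζ = c (Order.succ i) := fun i ↦ by
      by_cases hi : i < δ
      · obtain ⟨ζ, hζ, h⟩ := hf γ hγ (hcγ _ (hδ.succ_lt hi))
        exact ⟨ζ, hζ, fun _ ↦ h⟩
      · exact ⟨0, hmulim.bot_lt, fun h ↦ absurd h hi⟩
    have hidx' : ∀ i, ∃ ζ < mu.ord, i < δ →
        p (c (Order.succ i)) ζ = c '' Iio (Order.succ i) := fun i ↦ by
      by_cases hi : i < δ
      · obtain ⟨ζ, hζ, h⟩ := hp _ (hE.1 (hcE _ (hδ.succ_lt hi)))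
          (hcP _ (hδ.succ_lt hi) (Order.not_isSuccLimit_succ i))
        exact ⟨ζ, hζ, fun _ ↦ h⟩
      · exact ⟨0, hmulim.bot_lt, fun h ↦ absurd h hi⟩
    choose v hv hv' using hidx
    choose w hw hw' using hidx'
    obtain ⟨χ, hχ, hχ'⟩ := exists_cofinal_le hcof (h := fun i ↦ max (v i) (w i))
      fun i _ ↦ max_lt (hv i) (hw i)
    refine ⟨(γ, ⟨Order.succ χ, hmulim.succ_lt hχ⟩), c,
      ⟨⟨hγ, hc, hcγ, fun x hx ↦ ?_, hcP⟩, fun x hx ↦ ?_⟩, hcE⟩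
    · obtain ⟨_, ⟨i, hi, rfl⟩, h⟩ := exists_lt_of_lt_csSup hne hx
      exact ⟨i, hi, h⟩
    · obtain ⟨i, hi, hxi, h⟩ := hχ' x hx
      exact ⟨i, hi, hxi,
        ⟨v i, Order.lt_succ_iff.2 ((le_max_left _ _).trans h), hv' i hi⟩,
        ⟨w i, Order.lt_succ_iff.2 ((le_max_right _ _).trans h), hw' i hi⟩⟩
  -- Here `r` is the truth value of `p β ζ ⊆ E`. The pairs in `A` index cofinally many segments of
  -- every good sequence, so stability forces each good sequence through E' into the smaller club.
  obtain ⟨E', hE', hstab⟩ := exists_stable hmu (ι := Ordinal.{u} × Iio mu.ord)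
    (J := Ordinal.{u} × Ordinal.{u}) (r := fun E x ↦ if p x.1 x.2 ⊆ E then 1 else 0)
    (fun E E' hEE' x ↦ by
      by_cases h : p x.1 x.2 ⊆ E'
      · simp [h, h.trans hEE']
      · simp [h])
    (A := fun s ↦ (f s.1 '' Iio (s.2 : Ordinal)) ×ˢ Iio (s.2 : Ordinal))
    (fun s ↦ by
      rw [mk_setProd]
      exact mul_lt_of_lt (aleph0_le_lift.2 hmu) (mk_image_Iio_lt s.2.2 _) (mk_Iio_lt s.2.2))
    (G := fun s E ↦ ∃ c, good s.1 s.2 c ∧ ∀ i < δ, c i ∈ E)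
    (fun s E E' h ⟨c, hc, hcE⟩ ↦ ⟨c, hc, fun i hi ↦ h (hcE i hi)⟩) hgood
  have key : ∀ E, IsClubIn E lam.ord → ∃ χ < mu.ord, ∃ γ,
      (∃ c, good γ χ c ∧ ∀ i < δ, c i ∈ E') ∧
      ∀ c, good γ χ c → (∀ i < δ, c i ∈ E') → ∀ i < δ, c i ∈ E := by
    intro E hE
    obtain ⟨⟨γ, χ, hχ⟩, ⟨c, hc, hcE⟩, hst⟩ :=
      hstab _ (hE.inter hreg hunc hE') inter_subset_right
    refine ⟨χ, hχ, γ, ⟨c, hc, fun i hi ↦ (hcE i hi).2⟩, fun c' hc' hcE' i hi ↦ ?_⟩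
    obtain ⟨j, hj, hij, ⟨ζ, hζ, h1⟩, ⟨ζ', hζ', h2⟩⟩ := hc'.2 i hi
    have := hst (c' (Order.succ j), ζ') ⟨⟨ζ, hζ, h1⟩, hζ'⟩
    have hsub : c' '' Iio (Order.succ j) ⊆ E' := by
      rintro _ ⟨k, hk, rfl⟩
      exact hcE' k (lt_trans hk (hδ.succ_lt hj))
    simp only [h2] at this
    by_cases h : c' '' Iio (Order.succ j) ⊆ E ∩ E'
    · exact (h ⟨i, Order.lt_succ_iff.2 hij, rfl⟩).1
    · rw [if_neg h, if_pos hsub] at this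
      exact absurd this zero_ne_one
  obtain ⟨χ, -, hχ⟩ := exists_uniform_index hmu
    (Q := fun χ E ↦ ∃ γ, (∃ c, good γ χ c ∧ ∀ i < δ, c i ∈ E') ∧
      ∀ c, good γ χ c → (∀ i < δ, c i ∈ E') → ∀ i < δ, c i ∈ E)
    (fun χ E E'' h ⟨γ, h1, h2⟩ ↦ ⟨γ, h1, fun c hc hcE i hi ↦ h (h2 c hc hcE i hi)⟩) key
  have hC : ∀ γ, ∃ c, (∃ c', good γ χ c' ∧ ∀ i < δ, c' i ∈ E') →
      good γ χ c ∧ ∀ i < δ, c i ∈ E' := fun γ ↦ by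
    by_cases h : ∃ c', good γ χ c' ∧ ∀ i < δ, c' i ∈ E'
    · exact ⟨h.choose, fun _ ↦ h.choose_spec⟩
    · exact ⟨id, fun h' ↦ absurd h' h⟩
  choose C hC using hC
  refine ⟨{γ | ∃ c', good γ χ c' ∧ ∀ i < δ, c' i ∈ E'}, C, P, hP.mk_lt,
    fun γ hγ ↦ (hC γ hγ).1.1, fun E hE ↦ ?_⟩
  obtain ⟨γ, h1, h2⟩ := hχ E hE
  exact ⟨γ, h1, h2 _ (hC γ h1).1 (hC γ h1).2⟩

/-! ### Ranges of normal sequences, and the colouring -/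

theorem NormalOn.otp_image {c : Ordinal.{u} → Ordinal.{u}} {δ i : Ordinal.{u}} (hc : NormalOn c δ)
    (hi : i ≤ δ) : otp (c '' Iio i) = Ordinal.lift.{u + 1} i := by
  have hmono : StrictMonoOn c (Iio i) := fun j _ k hk hjk ↦ hc.lt _ _ hjk (lt_of_lt_of_le hk hi)
  rw [otp, ← Ordinal.type_lt_Iio]
  exact ((hmono.orderIso c (Iio i)).toRelIsoLT.ordinalType_congr).symm

theorem NormalOn.image_inter_Iio {c : Ordinal.{u} → Ordinal.{u}} {δ i : Ordinal.{u}}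
    (hc : NormalOn c δ) (hi : i < δ) : c '' Iio δ ∩ Iio (c i) = c '' Iio i := by
  ext y
  constructor
  · rintro ⟨⟨j, hj, rfl⟩, hji⟩
    exact ⟨j, (hc.lt_iff hj hi).1 hji, rfl⟩
  · rintro ⟨j, hj, rfl⟩
    exact ⟨⟨j, lt_trans hj hi, rfl⟩, hc.lt _ _ hj hi⟩

theorem NormalOn.exists_of_mem_nacc {c : Ordinal.{u} → Ordinal.{u}} {δ β : Ordinal.{u}}
    (hc : NormalOn c δ) (hβ : β ∈ nacc (c '' Iio δ)) :
    ∃ i < δ, ¬ Order.IsSuccLimit i ∧ β = c i := by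
  obtain ⟨⟨i, hi, rfl⟩, hacc⟩ := hβ
  refine ⟨i, hi, fun hlim ↦ hacc (SuccOrder.accPt_principal.2 ⟨?_, fun x hx ↦ ?_⟩), rfl⟩
  · exact not_isMin_iff.2 ⟨_, hc.lt _ _ hlim.bot_lt hi⟩
  · obtain ⟨j, hj, hxj⟩ := hc.exists_lt i hi hlim x hx
    exact ⟨c j, ⟨j, lt_trans hj hi, rfl⟩, hxj, hc.lt _ _ hj hi⟩

theorem NormalOn.mem_of_mem_closure {c : Ordinal.{u} → Ordinal.{u}} {δ γ x : Ordinal.{u}}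
    (hc : NormalOn c δ) (hγ : ∀ y < γ, ∃ i < δ, y < c i) (hxγ : x < γ)
    (hx : x ∈ closure (c '' Iio δ)) : x ∈ c '' Iio δ := by
  obtain ⟨h0, hsup⟩ := ((Ordinal.mem_closure_tfae x (c '' Iio δ)).out 0 2).1 hx
  obtain ⟨j, ⟨hj, hxj⟩, hmin⟩ := WellFounded.has_min (wellFounded_lt (α := Ordinal.{u}))
    {j | j < δ ∧ x < c j} (hγ x hxγ)
  have hmin' : ∀ k < j, c k ≤ x := fun k hk ↦
    le_of_not_gt fun h ↦ hmin k ⟨hk.trans hj, h⟩ hk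
  have hlt : ∀ k < δ, c k ≤ x → k < j := fun k hk hkx ↦ (hc.lt_iff hk hj).1 (hkx.trans_lt hxj)
  rcases Ordinal.zero_or_succ_or_isSuccLimit j with rfl | ⟨l, rfl⟩ | h
  · obtain ⟨_, ⟨k, hk, rfl⟩, hkx⟩ := h0
    exact absurd (hlt k hk hkx) not_lt_zero
  · have hl : l < δ := (Order.lt_succ l).trans hj
    refine ⟨l, hl, le_antisymm (hmin' l (Order.lt_succ l)) ?_⟩
    rw [← hsup]
    refine csSup_le h0 ?_
    rintro _ ⟨⟨k, hk, rfl⟩, hkx⟩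
    exact hc.le (Order.lt_succ_iff.1 (hlt k hk hkx)) hl
  · obtain ⟨k, hk, hxk⟩ := hc.exists_lt j hj h x hxj
    exact absurd (hmin' k hk) (not_le.2 hxk)

theorem NormalOn.isClubIn {c : Ordinal.{u} → Ordinal.{u}} {δ γ : Ordinal.{u}}
    (hc : NormalOn c δ) (hcγ : ∀ i < δ, c i < γ) (hγ : ∀ y < γ, ∃ i < δ, y < c i) :
    IsClubIn (c '' Iio δ) γ := by
  refine isClubIn_iff.2 ⟨?_, fun y hy ↦ ?_, fun x hx hx0 h ↦ hc.mem_of_mem_closure hγ hx ?_⟩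
  · rintro _ ⟨i, hi, rfl⟩
    exact hcγ i hi
  · obtain ⟨i, hi, h⟩ := hγ y hy
    exact ⟨_, ⟨i, hi, rfl⟩, h.le⟩
  · obtain ⟨z, hz, -, hzx⟩ := h 0 (pos_iff_ne_zero.2 hx0)
    have hne : (c '' Iio δ ∩ Iic x).Nonempty := ⟨z, hz, hzx⟩
    have hiff := (Ordinal.mem_closure_tfae x (c '' Iio δ)).out 0 2
    refine hiff.2 ⟨hne, le_antisymm (csSup_le hne fun y hy ↦ hy.2) (le_of_not_gt fun hlt ↦ ?_)⟩
    obtain ⟨w, hw, hlt', hwx⟩ := h _ hlt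
    exact hlt'.not_ge (le_csSup ⟨x, fun y hy ↦ hy.2⟩ ⟨hw, hwx⟩)

theorem NormalOn.isClosedIn {c : Ordinal.{u} → Ordinal.{u}} {δ γ β : Ordinal.{u}}
    (hc : NormalOn c δ) (hγ : ∀ y < γ, ∃ i < δ, y < c i) (hβ : β ≤ γ) :
    IsClosedIn (c '' Iio δ ∩ Iio β) β := by
  refine ⟨inter_subset_right, ?_⟩
  have : Iio β ↓∩ (c '' Iio δ ∩ Iio β) = Iio β ↓∩ closure (c '' Iio δ) := by
    ext x
    have hx : (x : Ordinal) < β := x.2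
    simp only [mem_preimage, mem_inter_iff, mem_Iio, hx, and_true]
    exact ⟨fun h ↦ subset_closure h, hc.mem_of_mem_closure hγ (hx.trans_le hβ)⟩
  rw [this]
  exact isClosed_closure.preimage continuous_subtype_val

theorem NormalOn.cof_eq {c : Ordinal.{u} → Ordinal.{u}} {δ γ : Ordinal.{u}}
    (hδ : Order.IsSuccLimit δ) (hc : NormalOn c δ) (hcγ : ∀ i < δ, c i < γ)
    (hγ : ∀ y < γ, ∃ i < δ, y < c i) : γ.cof = δ.cof := by
  have hmono : StrictMono fun i : Iio δ ↦ c i := fun i j hij ↦ hc.lt _ _ hij j.2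
  rw [← Ordinal.cof_iSup_Iio hmono hδ.isSuccPrelimit]
  congr 1
  have : Nonempty (Iio δ) := ⟨⟨0, hδ.bot_lt⟩⟩
  have hb : BddAbove (range fun i : Iio δ ↦ c i) := ⟨γ, by rintro _ ⟨i, rfl⟩; exact (hcγ i i.2).le⟩
  refine le_antisymm (le_of_forall_lt fun y hy ↦ ?_) (ciSup_le fun i ↦ (hcγ i i.2).le)
  obtain ⟨i, hi, h⟩ := hγ y hy
  exact h.trans_le (le_ciSup hb ⟨i, hi⟩)

/-- A regressive map to small sets has a colouring with few colours. -/
theorem exists_coloring {mu : Cardinal.{u}} {δ : Ordinal.{u}} (hcard : δ.card < mu)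
    (C : Ordinal.{u} → Ordinal.{u} → Ordinal.{u}) :
    ∃ col : Ordinal.{u} → Ordinal.{u}, ∀ γ, (∀ i < δ, C γ i < γ) →
      col γ < mu.ord ∧ ∀ i < δ, col (C γ i) ≠ col γ := by
  obtain ⟨col, hcol⟩ := exists_recursion fun γ (g : Ordinal.{u} → Ordinal.{u}) ↦
    sInf {x | ∀ i < δ, g (C γ i) ≠ x}
  refine ⟨col, fun γ hγ ↦ ?_⟩
  have h : col γ = sInf {x | ∀ i < δ, col (C γ i) ≠ x} := by
    obtain ⟨g, hg, h⟩ := hcol γ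
    rw [h]
    congr 1
    ext x
    exact forall₂_congr fun i hi ↦ by rw [hg _ (hγ i hi)]
  -- At most |δ| < `mu` colours are forbidden at γ.
  obtain ⟨x, hx, hx'⟩ : ∃ x < mu.ord, ∀ i < δ, col (C γ i) ≠ x := by
    by_contra! H
    have hsub : Iio mu.ord ⊆ (fun i ↦ col (C γ i)) '' Iio δ := fun x hx ↦ H x hx
    refine (mk_le_mk_of_subset hsub).not_gt ?_
    rw [mk_Iio_ordinal, card_ord]
    exact mk_image_Iio_lt (lt_ord.2 hcard) _
  have hx' : x ∈ {x | ∀ i < δ, col (C γ i) ≠ x} := hx'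
  have hmem := csInf_mem ⟨x, hx'⟩
  rw [← h] at hmem
  refine ⟨?_, hmem⟩
  rw [h]
  exact (csInf_le' hx').trans_lt hx

end ClubGuessing

/-! ### Assembly -/

theorem claim1p12 (lam mu : Cardinal.{u}) (δ : Ordinal.{u})
    (hlam : lam = Order.succ mu) (hδ : Order.IsSuccLimit δ)
    (hcard : δ.card < mu) (hcof : δ.cof ≠ mu.ord.cof) :
    ∃ (S : Set Ordinal.{u}) (P : Ordinal.{u} → Set (Set Ordinal.{u})),
      S ⊆ {α | α < lam.ord ∧ α.cof = δ.cof} ∧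
      ClubGuessing.IsStationaryIn S lam.ord ∧
      ClubGuessing.GuessesClubs lam δ P S := by
  open ClubGuessing in
  subst hlam
  have hmu : ℵ₀ ≤ mu :=
    (Ordinal.aleph0_le_card.2 (Ordinal.omega0_le_of_isSuccLimit hδ)).trans hcard.le
  obtain ⟨S₀, C, P, hPcard, hS₀, hguess⟩ := exists_guess_sequence hδ hcard hcof
  obtain ⟨col, hcol⟩ := exists_coloring hcard C
  obtain ⟨χ, -, hχ⟩ := exists_uniform_index hmu
    (Q := fun χ E ↦ ∃ γ ∈ S₀, col γ = χ ∧ ∀ i < δ, C γ i ∈ E)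
    (fun χ E E' h ⟨γ, hγ, h1, h2⟩ ↦ ⟨γ, hγ, h1, fun i hi ↦ h (h2 i hi)⟩)
    fun E hE ↦ by
      obtain ⟨γ, hγ, h⟩ := hguess E hE
      exact ⟨col γ, (hcol γ (hS₀ γ hγ).2.2.1).1, γ, hγ, rfl, h⟩
  let S := {γ | γ ∈ S₀ ∧ col γ = χ}
  have hnot : ∀ γ ∈ S, ∀ i < δ, C γ i ∉ S := fun γ hγ i hi h ↦
    (hcol γ (hS₀ γ hγ.1).2.2.1).2 i hi (h.2.trans hγ.2.symm)
  classical
  -- Off S only the segments required by coherence are kept. They belong to `P α`, which bounds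
  -- their number. No conflict arises on S, since the sequences avoid S.
  let P' : Ordinal.{u} → Set (Set Ordinal.{u}) := fun α ↦ if α ∈ S then {C α '' Iio δ} else
    {Q | ∃ γ ∈ S, α ∈ nacc (C γ '' Iio δ) ∧ Q = C γ '' Iio δ ∩ Iio α}
  have hP'S : ∀ α ∈ S, P' α = {C α '' Iio δ} := fun α hα ↦ if_pos hα
  have hP'N : ∀ α, α ∉ S → P' α =
      {Q | ∃ γ ∈ S, α ∈ nacc (C γ '' Iio δ) ∧ Q = C γ '' Iio δ ∩ Iio α} := fun α hα ↦ if_neg hα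
  have hclub : ∀ γ ∈ S, IsClubIn (C γ '' Iio δ) γ := fun γ hγ ↦
    (hS₀ γ hγ.1).2.1.isClubIn (hS₀ γ hγ.1).2.2.1 (hS₀ γ hγ.1).2.2.2.1
  refine ⟨S, P', fun γ hγ ↦ ⟨(hS₀ γ hγ.1).1, (hS₀ γ hγ.1).2.1.cof_eq hδ (hS₀ γ hγ.1).2.2.1
    (hS₀ γ hγ.1).2.2.2.1⟩, ⟨fun γ hγ ↦ (hS₀ γ hγ.1).1, fun t ht ↦ ?_⟩, ?_, ?_, ?_, ?_, ?_⟩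
  · have hE : IsClubIn (Subtype.val '' t) (Order.succ mu).ord := by
      refine ⟨by rintro _ ⟨x, -, rfl⟩; exact x.2, ?_⟩
      rwa [preimage_image_eq _ Subtype.val_injective]
    obtain ⟨γ, hγ, hγχ, h⟩ := hχ _ hE
    obtain ⟨hγlam, hc, hcγ, hγc, -⟩ := hS₀ γ hγ
    -- The guess is cofinal in γ and lies in the club, so γ is a limit of the club.
    have : γ ∈ Subtype.val '' t := by
      refine (isClubIn_iff.1 hE).2.2 γ hγlam ?_ fun y hy ↦ ?_
      · rintro rfl
        exact not_lt_zero (hcγ 0 hδ.bot_lt)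
      · obtain ⟨i, hi, hyi⟩ := hγc y hy
        exact ⟨_, h i hi, hyi, (hcγ i hi).le⟩
    obtain ⟨x, hx, rfl⟩ := this
    exact ⟨x, ⟨hγ, hγχ⟩, hx⟩
  · intro α hα
    by_cases hαS : α ∈ S
    · rw [hP'S α hαS]
      refine ⟨?_, ?_⟩
      · rintro _ rfl
        obtain ⟨-, hc, hcα, hαc, -⟩ := hS₀ α hαS.1
        have := hc.isClosedIn hαc le_rfl
        rwa [inter_eq_left.2 (hclub α hαS).1] at this
      · rw [mk_singleton]
        exact one_lt_aleph0.trans_le (aleph0_le_lift.2 (hmu.trans (Order.le_succ mu)))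
    · rw [hP'N α hαS]
      refine ⟨?_, (mk_le_mk_of_subset ?_).trans_lt (hPcard α hα)⟩
      · rintro _ ⟨γ, hγ, hαγ, rfl⟩
        obtain ⟨-, hc, hcγ, hγc, -⟩ := hS₀ γ hγ.1
        exact hc.isClosedIn hγc (le_of_lt ((hclub γ hγ).1 hαγ.1))
      · rintro _ ⟨γ, hγ, hαγ, rfl⟩
        obtain ⟨-, hc, -, -, hcP⟩ := hS₀ γ hγ.1
        obtain ⟨i, hi, hilim, rfl⟩ := hc.exists_of_mem_nacc hαγ
        rw [hc.image_inter_Iio hi]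
        exact hcP i hi hilim
  · intro α _ hαS Q hQ
    rw [hP'N α hαS] at hQ
    obtain ⟨γ, hγ, hαγ, rfl⟩ := hQ
    have hc := (hS₀ γ hγ.1).2.1
    obtain ⟨i, hi, -, rfl⟩ := hc.exists_of_mem_nacc hαγ
    rw [hc.image_inter_Iio hi, hc.otp_image hi.le, Ordinal.lift_lt]
    exact hi
  · intro α hα
    refine ⟨_, hP'S α hα, (hS₀ α hα.1).2.1.otp_image le_rfl, hclub α hα, ?_⟩
    rw [Set.disjoint_left]
    rintro _ ⟨i, hi, rfl⟩
    exact hnot α hα i hi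
  · intro α _ Q hQ β hβ
    obtain ⟨γ, hγ, hβγ, hQβ⟩ : ∃ γ ∈ S, β ∈ nacc (C γ '' Iio δ) ∧
        Q ∩ Iio β = C γ '' Iio δ ∩ Iio β := by
      by_cases hαS : α ∈ S
      · rw [hP'S α hαS, mem_singleton_iff] at hQ
        subst hQ
        exact ⟨α, hαS, hβ, rfl⟩
      · rw [hP'N α hαS] at hQ
        obtain ⟨γ, hγ, hαγ, rfl⟩ := hQ
        have hβα : β < α := hβ.1.2
        refine ⟨γ, hγ, ⟨hβ.1.1, fun hacc ↦ hβ.2 ?_⟩, ?_⟩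
        · rw [SuccOrder.accPt_principal] at hacc ⊢
          refine ⟨hacc.1, fun x hx ↦ ?_⟩
          obtain ⟨y, hy, hxy, hyβ⟩ := hacc.2 x hx
          exact ⟨y, ⟨hy, lt_trans hyβ hβα⟩, hxy, hyβ⟩
        · rw [inter_assoc, Iio_inter_Iio, min_eq_right hβα.le]
    rw [hP'N β ?_]
    · exact ⟨γ, hγ, hβγ, hQβ⟩
    · obtain ⟨i, hi, rfl⟩ := hβγ.1
      exact hnot γ hγ i hi
  · intro E hE
    obtain ⟨γ, hγ, hγχ, h⟩ := hχ E hE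
    refine ⟨γ, ⟨hγ, hγχ⟩, _, (hP'S γ ⟨hγ, hγχ⟩).symm ▸ mem_singleton _, ?_⟩
    rintro _ ⟨i, hi, rfl⟩
    exact h i hi
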